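/- **Theorem (Joining of d-trees).** Let $d\ge 2$, $C_{obs}\subseteq C\subseteq\mathbb R^d$, and let the free space $F=C_{free}=\overline{C\setminus C_{obs}}$ be bounded. For $q\in F$ let $\mathcal V(q)$ be the set of $p\in F$ such that the segment $[q,p]$ lies in $F$, and let $\mu$ be Lebesgue measure. Assume that $F$ is $(\alpha,\beta,\delta)$-expansive for some $\alpha,\beta,\delta>0$: for every connected component $C'$ of $F$, (i) $\mu(\mathcal V(q))\ge\delta$ for all $q\in C'$, and (ii) for every connected, Lebesgue measurable $S\subseteq C'$, the set $\{q\in S:\mu(\mathcal V(q)\setminus S)\ge\beta\,\mu(C'\setminus S)\}$ has measure at least $\alpha\,\mu(S)$. Run the planner RRdT* without a bound on the number of iterations, from a root $q_{init}\in F$, with $k\ge1$ arms, step size $\epsilon>0$ and restart threshold $\eta>0$: - The state consists of the positions of the $k$ arms and a set $D$ of trees (d-trees) with nodes in $\mathbb R^d$. Initially the arms stand at $k$ independent uniform random points of $F$, and $D$ consists of a one-node tree at $q_{init}$ and a one-node tree at each of these $k$ points. - *Adding a point $q$* means: $q$ is joined by an edge to each tree of $D$ that has a node $v$ with $|v-q|\le\epsilon$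 and $[v,q]\subseteq F$ (one edge per tree, to some such node; no edge to a tree that already contains $q$), and all these trees and $q$ become one tree. If there is no such tree, $q$ becomes a new one-node tree. The tree that contains $q_{init}$ may afterwards be rewired, i.e. replaced by a tree on the same nodes with edges that are segments in $F$. - In each iteration every arm has a probability in $[0,1]$. If some arm has probability less than $\eta$, one such arm is restarted: a new point $q$ is sampled uniformly from $F$ (all uniform samples are independent), and $q$ is added; if it was joined to no tree, the arm is moved to $q$ (the arm is *replaced*). Otherwise an arm is picked, and it proposes a point $q$ within distance $\epsilon$ of its position $a$; if $[a,q]\subseteq F$, then $q$ is added and the arm moves to $q$; else nothing changes. The rule by which arms are picked, the proposal distributions of the local samples, and the update of the arm probabilities are arbitrary, except for the discounting assumption: almost surely, the probability of each arm that is picked infinitely often and replaced only finitely often tends to $0$. Then the following hold. 1. Almost surely, whenever $d_i\ne d_j$ are two d-trees that are present at some time $t$ and have all their nodes in the same connected component of $F$, and some continuous path in $F$ joins a node of $d_i$ to a node of $d_j$, there is a time $t_0$ such that at every time $s\ge t_0$ a single d-tree contains all nodes of $d_i$ and of $d_j$. 2. Almost surely, for every connected component $C'$ of $F$ there is a time $t_0$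 such that at every time $s\ge t_0$ exactly one d-tree has all its nodes in $C'$. -/

import Mathlib

open MeasureTheory ProbabilityTheory Filter Topology

namespace RRdT

/-! ### Configuration space, visibility, expansiveness -/

/-- The ambient space `ℝ^d` with its Euclidean norm. -/
abbrev Conf (d : ℕ) : Type := EuclideanSpace ℝ (Fin d)

/-- The obstacle-free space: the closure of `C \ C_obs`. -/
def freeSpace {d : ℕ} (C Cobs : Set (Conf d)) : Set (Conf d) := closure (C \ Cobs)

/-- The visibility set of `q`: the points of the free space `F` that the straight segment from `q`
reaches without leaving `F`. -/
def visibility {d : ℕ} (F : Set (Conf d)) (q : Conf d) : Set (Conf d) :=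
  {p | p ∈ F ∧ segment ℝ q p ⊆ F}

/-- The `β`-lookout of a subset `S` of the component `C'`. -/
def lookout {d : ℕ} (F C' : Set (Conf d)) (β : ℝ) (S : Set (Conf d)) : Set (Conf d) :=
  {q | q ∈ S ∧ ENNReal.ofReal β * volume (C' \ S) ≤ volume (visibility F q \ S)}

/-- `(α, β, ε)`-expansiveness of `F`. The connected components of `F` are the sets
`connectedComponentIn F x`, `x ∈ F`; the sets `S` whose volume is taken are Lebesgue measurable. -/
structure IsExpansive {d : ℕ} (F : Set (Conf d)) (α β ε : ℝ) : Prop where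
  good : ∀ x ∈ F, ∀ q ∈ connectedComponentIn F x, ENNReal.ofReal ε ≤ volume (visibility F q)
  lookout_le : ∀ x ∈ F, ∀ S : Set (Conf d), S ⊆ connectedComponentIn F x → IsConnected S →
    NullMeasurableSet S volume →
    ENNReal.ofReal α * volume S ≤ volume (lookout F (connectedComponentIn F x) β S)

/-! ### d-trees and the operations on them -/

/-- A d-tree is a graph `G(V, E)` with vertices in `ℝ^d`. -/
abbrev DTree (d : ℕ) : Type := (⊤ : SimpleGraph (Conf d)).Subgraph

/-- The d-tree `G({q}, ∅)`. -/
def DTree.single {d : ℕ} (q : Conf d) : DTree d := (⊤ : SimpleGraph (Conf d)).singletonSubgraph q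

/-- A node `v` and a point `q` can be linked by an edge: they are within distance `ε`, and the
straight segment between them is collision-free. -/
def CanLink {d : ℕ} (F : Set (Conf d)) (ε : ℝ) (v q : Conf d) : Prop :=
  dist v q ≤ ε ∧ segment ℝ v q ⊆ F

/-- The trees of `D` to which the point `q` is joined. -/
def joinable {d : ℕ} (F : Set (Conf d)) (ε : ℝ) (D : Set (DTree d)) (q : Conf d) :
    Set (DTree d) :=
  {T | T ∈ D ∧ ∃ v ∈ T.verts, CanLink F ε v q}

/-- `T'` arises by joining `q` to all trees in `J`: its vertices are `q` and those of the trees in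
`J`; its edges are those of the trees in `J`, and for each `T ∈ J` one edge that links `q` to a node
`c T` of `T` (no edge if `q` is already a node of `T`). For `J = ∅`, it is the new tree
`G({q}, ∅)`. -/
def IsJoinOf {d : ℕ} (F : Set (Conf d)) (ε : ℝ) (J : Set (DTree d)) (q : Conf d)
    (T' : DTree d) : Prop :=
  T'.verts = insert q (⋃ T ∈ J, T.verts) ∧
  ∃ c : DTree d → Conf d,
    (∀ T ∈ J, c T ∈ T.verts ∧ CanLink F ε (c T) q ∧ (q ∈ T.verts → c T = q)) ∧
    ∀ x y, T'.Adj x y ↔ ∃ T ∈ J, T.Adj x y ∨ (x ≠ y ∧ s(x, y) = s(q, c T))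

/-- `T'` is a rewiring of `T`: a tree on the same vertices, with collision-free edges. -/
def IsRewiring {d : ℕ} (F : Set (Conf d)) (T T' : DTree d) : Prop :=
  T'.verts = T.verts ∧ T'.coe.IsTree ∧ ∀ x y, T'.Adj x y → segment ℝ x y ⊆ F

/-- The set `D` of d-trees becomes `D'` when `q` is added: the trees joined by `q` are replaced by
the joined tree (a new tree at `q` if there are none), which may be rewired if it is the tree
that contains the root `qInit`. -/
def AddPoint {d : ℕ} (F : Set (Conf d)) (ε : ℝ) (qInit : Conf d) (D : Set (DTree d)) (q : Conf d)
    (D' : Set (DTree d)) : Prop :=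
  ∃ T₁ T₂ : DTree d, IsJoinOf F ε (joinable F ε D q) q T₁ ∧
    (T₂ = T₁ ∨ (qInit ∈ T₁.verts ∧ IsRewiring F T₁ T₂)) ∧
    D' = insert T₂ (D \ joinable F ε D q)

/-! ### The algorithm -/

/-- The set `A` of the positions of the `k` arms, together with the set `D` of d-trees. -/
structure State (d k : ℕ) where
  pos : Fin k → Conf d
  trees : Set (DTree d)

/-- The scheduler restarts arm `i` at the sample `q`: `q` is joined to the trees it can be linked to;
only if there are none, a new tree is created at `q`, and the arm is moved there. -/
def RestartStep {d k : ℕ} (F : Set (Conf d)) (ε : ℝ) (qInit : Conf d) (s : State d k) (i : Fin k)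
    (q : Conf d) (s' : State d k) : Prop :=
  AddPoint F ε qInit s.trees q s'.trees ∧
  (joinable F ε s.trees q = ∅ → s'.pos = Function.update s.pos i q) ∧
  ((joinable F ε s.trees q).Nonempty → s'.pos = s.pos)

/-- Arm `i` makes the local move to `q`: if the segment to `q` is collision-free then `q` is joined
to the trees it can be linked to, and the arm moves to `q`; otherwise nothing changes. -/
def LocalStep {d k : ℕ} (F : Set (Conf d)) (ε : ℝ) (qInit : Conf d) (s : State d k) (i : Fin k)
    (q : Conf d) (s' : State d k) : Prop :=
  (segment ℝ (s.pos i) q ⊆ F →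
    AddPoint F ε qInit s.trees q s'.trees ∧ s'.pos = Function.update s.pos i q) ∧
  (¬ segment ℝ (s.pos i) q ⊆ F → s' = s)

/-- The initial state: the arm `i` stands at `x i`, and the trees are the root tree at `qInit` and
one tree at each `x i`. -/
def initState {d k : ℕ} (qInit : Conf d) (x : Fin k → Conf d) : State d k where
  pos := x
  trees := insert (DTree.single qInit) (Set.range fun i => DTree.single (x i))

/-- A random run, without a bound on the number of iterations, of the planner with `k` arms, step
size `ε` and restart threshold `η`, in the free space `F`, from the root `qInit`.

The `n`-th call of the sampler of the free space returns `sample n`. How an arm is picked, the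
proposal distribution of a local sampler (any distribution on steps of length at most `ε`) and the
rule that updates the arm probabilities may be arbitrary, and may depend on the past in any
way. -/
structure Run {d : ℕ} (F : Set (Conf d)) (qInit : Conf d) (k : ℕ) (ε η : ℝ)
    {Ω : Type*} [MeasurableSpace Ω] (P : Measure Ω) where
  /-- The results of the successive calls of the sampler of the free space. -/
  sample : ℕ → Ω → Conf d
  /-- The state at the start of each iteration. -/
  state : ℕ → Ω → State d k
  /-- The arm probabilities at the start of each iteration. -/
  prob : ℕ → Ω → Fin k → ℝ
  /-- The arm that is restarted or picked in each iteration. -/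
  arm : ℕ → Ω → Fin k
  /-- The local sample drawn in an iteration (used only if no arm is restarted). -/
  proposal : ℕ → Ω → Conf d
  measurable_sample : ∀ n, Measurable (sample n)
  indep_sample : iIndepFun sample P
  uniform_sample : ∀ n, pdf.IsUniform (sample n) F P volume
  prob_mem : ∀ᵐ ω ∂P, ∀ t i, prob t ω i ∈ Set.Icc (0 : ℝ) 1
  init : ∀ᵐ ω ∂P, state 0 ω = initState qInit (fun i : Fin k => sample i ω)
  /-- An iteration in which some arm has probability below `η` restarts such an arm at the next
  sample of the free space. -/
  restart_step : ∀ᵐ ω ∂P, ∀ t, (∃ i, prob t ω i < η) →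
    prob t ω (arm t ω) < η ∧
    ∃ n, n = k + {s | s < t ∧ ∃ i, prob s ω i < η}.ncard ∧
      RestartStep F ε qInit (state t ω) (arm t ω) (sample n ω) (state (t + 1) ω)
  /-- In all other iterations, the picked arm makes a local step. -/
  local_step : ∀ᵐ ω ∂P, ∀ t, (¬ ∃ i, prob t ω i < η) →
    dist ((state t ω).pos (arm t ω)) (proposal t ω) ≤ ε ∧
    LocalStep F ε qInit (state t ω) (arm t ω) (proposal t ω) (state (t + 1) ω)

namespace Run

variable {d : ℕ} {F : Set (Conf d)} {qInit : Conf d} {k : ℕ} {ε η : ℝ}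
  {Ω : Type*} [MeasurableSpace Ω] {P : Measure Ω}

/-- Iteration `t` is spent on a restart. -/
def Restarts (R : Run F qInit k ε η P) (ω : Ω) (t : ℕ) : Prop := ∃ i, R.prob t ω i < η

/-- Arm `i` is picked for local sampling in iteration `t`. -/
def Picked (R : Run F qInit k ε η P) (ω : Ω) (i : Fin k) (t : ℕ) : Prop :=
  ¬ R.Restarts ω t ∧ R.arm t ω = i

/-- Arm `i` is replaced by a new arm in iteration `t`. -/
def Replaced (R : Run F qInit k ε η P) (ω : Ω) (i : Fin k) (t : ℕ) : Prop :=
  R.Restarts ω t ∧ R.arm t ω = i ∧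
    joinable F ε (R.state t ω).trees
      (R.sample (k + {s | s < t ∧ R.Restarts ω s}.ncard) ω) = ∅

/-- The discounting assumption on the scheduler: almost surely, the probability of an arm that is
used again and again, and never replaced, decays to zero. -/
def ArmsDecay (R : Run F qInit k ε η P) : Prop :=
  ∀ᵐ ω ∂P, ∀ i, (∃ᶠ t in atTop, R.Picked ω i t) → (∀ᶠ t in atTop, ¬ R.Replaced ω i t) →
    Tendsto (fun t => R.prob t ω i) atTop (𝓝 0)

/-- The set `D` of d-trees at time `t`. -/
def trees (R : Run F qInit k ε η P) (ω : Ω) (t : ℕ) : Set (DTree d) := (R.state t ω).trees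

end Run

end RRdT

/-!
The proof separates the randomness from the planner. A link is a free segment of length at most the
step size `ε`. Every sample of the free space becomes a node, and when it is added it is joined to
all earlier nodes that can be linked to it. So the only random input is the sequence `x` of
independent uniform samples. The picked arms, the local samples and the rewirings are arbitrary
functions of the outcome and may even anticipate future samples. This does no harm: a local step
starts from a node, so it joins its point to an existing tree and never creates a new one.

*The samples* (`ae_goodSamples`). The set `reach z` of the points that can be linked to `z` contains
a shrunk copy of the star-shaped visibility set of `z`, so its volume is at least a constant `c > 0`
(`exists_pos_forall_le_volume_reach`). Two facts follow almost surely.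

* All but finitely many samples can be linked to an earlier one, since the `n`-th sample fails to do
  so with probability at most `(1 - c') ^ n`, where `c' > 0` is `c` divided by the volume of the free
  space (`ae_eventually_exists_lt_mem`).
* The graph of links between the samples is connected in each component. Let `S` be the union of the
  sets `reach (x m)` over one class of samples. This set is connected. If `reach (x m)` and `reach y`
  overlap in a non-null set, then some sample falls into the overlap, for all `m` and almost all `y`;
  so almost no link leaves `S`. If `S` did not fill its component up to a null set, expansiveness
  would give a set of positive measure of free segments `[q, p]` that leave `S`. Each is cut into
  pieces of length at most `ε`, some piece is a link that leaves `S`, and the end points of the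
  `j`-th piece depend on `(q, p)` through a linear isomorphism, so the links that leave `S` would not
  be null (`volume_connectedComponentIn_diff_eq_zero`). Hence the class fills its component. So for
  any other sample `x n` there, `reach (x n)` overlaps some `reach (x m)` in a non-null set, and a
  sample in the overlap links `x n` to the class.

*The planner* (`IsTrajectory`). By the discounting assumption restarts never cease
(`frequently_restarts`), so all samples are used. Nodes that once share a tree share one forever.
Every tree contains the root or a sample, and the root can be linked to a sample, so all trees inside
one component merge eventually (`IsTrajectory.eventually_verts_union_subset`). As only finitely many
trees are ever created, a single one is left in each component
(`IsTrajectory.eventually_existsUnique`).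
-/

namespace RRdT

/-! ### Geometry of the linking relation -/

section Geometry

variable {d : ℕ} {F : Set (Conf d)} {ε : ℝ}

theorem CanLink.symm {x y : Conf d} (h : CanLink F ε x y) : CanLink F ε y x :=
  ⟨dist_comm x y ▸ h.1, segment_symm ℝ x y ▸ h.2⟩

theorem CanLink.right_mem {x y : Conf d} (h : CanLink F ε x y) : y ∈ F :=
  h.2 (right_mem_segment ℝ x y)

theorem canLink_self {x : Conf d} (hε : 0 ≤ ε) (hx : x ∈ F) : CanLink F ε x x :=
  ⟨by simpa using hε, by simpa using hx⟩

theorem connectedComponentIn_eq_of_segment_subset {x y : Conf d} (h : segment ℝ x y ⊆ F) :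
    connectedComponentIn F x = connectedComponentIn F y :=
  connectedComponentIn_eq <|
    (convex_segment x y).isPreconnected.subset_connectedComponentIn (left_mem_segment ℝ x y) h
      (right_mem_segment ℝ x y)

theorem CanLink.connectedComponentIn_eq {x y : Conf d} (h : CanLink F ε x y) :
    connectedComponentIn F x = connectedComponentIn F y :=
  connectedComponentIn_eq_of_segment_subset h.2

theorem isClosed_segment_subset (hF : IsClosed F) :
    IsClosed {p : Conf d × Conf d | segment ℝ p.1 p.2 ⊆ F} := by
  have : {p : Conf d × Conf d | segment ℝ p.1 p.2 ⊆ F} =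
      ⋂ t ∈ Set.Icc (0 : ℝ) 1, {p : Conf d × Conf d | AffineMap.lineMap p.1 p.2 t ∈ F} := by
    ext p
    simp only [segment_eq_image_lineMap, Set.image_subset_iff, Set.mem_ofPred_eq, Set.mem_iInter]
    rfl
  rw [this]
  refine isClosed_biInter fun t _ => hF.preimage ?_
  simp only [AffineMap.lineMap_apply_module]
  fun_prop

theorem isClosed_canLink (hF : IsClosed F) :
    IsClosed {p : Conf d × Conf d | CanLink F ε p.1 p.2} :=
  (isClosed_le (continuous_fst.dist continuous_snd) continuous_const).inter
    (isClosed_segment_subset hF)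

/-- The points that can be linked to `z`. -/
def reach (F : Set (Conf d)) (ε : ℝ) (z : Conf d) : Set (Conf d) := {p | CanLink F ε z p}

theorem isClosed_reach (hF : IsClosed F) (z : Conf d) : IsClosed (reach F ε z) :=
  (isClosed_canLink hF).preimage (f := fun p => (z, p)) (by fun_prop)

theorem reach_subset (z : Conf d) : reach F ε z ⊆ F := fun _ h => CanLink.right_mem h

theorem reach_subset_connectedComponentIn (z : Conf d) :
    reach F ε z ⊆ connectedComponentIn F z := fun p h => by
  rw [CanLink.connectedComponentIn_eq h]
  exact mem_connectedComponentIn (CanLink.right_mem h)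

theorem starConvex_reach (z : Conf d) : StarConvex ℝ z (reach F ε z) := by
  rw [starConvex_iff_segment_subset]
  intro y hy p hp
  refine ⟨?_, ((convex_segment z y).segment_subset (left_mem_segment ℝ z y) hp).trans hy.2⟩
  have := dist_add_dist_of_mem_segment hp
  have := hy.1
  have := dist_nonneg (x := p) (y := y)
  linarith

theorem isConnected_reach (hε : 0 ≤ ε) {z : Conf d} (hz : z ∈ F) : IsConnected (reach F ε z) :=
  ((starConvex_reach z).isPathConnected (canLink_self hε hz)).isConnected

/-- Shrinking the star-shaped visibility set towards `z` brings it within the step size, at the cost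
of a factor that depends only on the diameter of `F`. -/
theorem exists_pos_forall_le_volume_reach (hbdd : Bornology.IsBounded F) (hε : 0 < ε) {δ : ℝ}
    (hδ : 0 < δ) (hvis : ∀ z ∈ F, ENNReal.ofReal δ ≤ volume (visibility F z)) :
    ∃ c : ENNReal, 0 < c ∧ ∀ z ∈ F, c ≤ volume (reach F ε z) := by
  have hD : 0 ≤ Metric.diam F := Metric.diam_nonneg
  set τ : ℝ := ε / (ε + Metric.diam F) with hτ
  have hτ0 : 0 < τ := by positivity
  have hτ1 : τ ≤ 1 := by rw [hτ, div_le_one (by positivity)]; linarith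
  have hτD : τ * Metric.diam F ≤ ε := by
    rw [hτ, div_mul_eq_mul_div, div_le_iff₀ (by positivity)]
    nlinarith
  refine ⟨ENNReal.ofReal |τ ^ Module.finrank ℝ (Conf d)| * ENNReal.ofReal δ, ?_, fun z hz => ?_⟩
  · refine ENNReal.mul_pos ?_ ?_
    · exact (ENNReal.ofReal_pos.2 (abs_pos.2 (pow_pos hτ0 _).ne')).ne'
    · simpa using hδ
  · calc _ ≤ ENNReal.ofReal |τ ^ Module.finrank ℝ (Conf d)| * volume (visibility F z) := by
          gcongr; exact hvis z hz
      _ = volume (AffineMap.homothety z τ '' visibility F z) :=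
          (Measure.addHaar_image_homothety _ _ _ _).symm
      _ ≤ _ := by
          refine measure_mono ?_
          rintro _ ⟨p, hp, rfl⟩
          have hm : AffineMap.homothety z τ p ∈ segment ℝ z p := by
            rw [segment_eq_image_lineMap, AffineMap.homothety_eq_lineMap]
            exact ⟨τ, ⟨hτ0.le, hτ1⟩, rfl⟩
          refine ⟨?_, ((convex_segment z p).segment_subset
            (left_mem_segment ℝ z p) hm).trans hp.2⟩
          rw [AffineMap.homothety_eq_lineMap, dist_left_lineMap, Real.norm_of_nonneg hτ0.le]
          exact (mul_le_mul_of_nonneg_left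
            (Metric.dist_le_diam_of_mem hbdd hz hp.1) hτ0.le).trans hτD

/-- The map that sends `(q, p)` to the points at two distinct parameters `s`, `t` of the line through
`q` and `p` is a linear isomorphism, so it pulls null sets back to null sets. -/
theorem volume_preimage_lineMap_prod {s t : ℝ} (hst : s ≠ t) {H : Set (Conf d × Conf d)}
    (hH : (volume : Measure (Conf d × Conf d)) H = 0) :
    (volume : Measure (Conf d × Conf d))
      ((fun p : Conf d × Conf d =>
        ((AffineMap.lineMap p.1 p.2 s : Conf d), (AffineMap.lineMap p.1 p.2 t : Conf d))) ⁻¹' H)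
      = 0 := by
  let f : (Conf d × Conf d) →ₗ[ℝ] (Conf d × Conf d) :=
    ((1 - s) • LinearMap.fst ℝ (Conf d) (Conf d) + s • LinearMap.snd ℝ _ _).prod
      ((1 - t) • LinearMap.fst ℝ (Conf d) (Conf d) + t • LinearMap.snd ℝ _ _)
  have hf : Function.Injective f := by
    rw [injective_iff_map_eq_zero]
    rintro ⟨q, p⟩ h
    have h1 : (1 - s) • q + s • p = 0 := congrArg Prod.fst h
    have h2 : (1 - t) • q + t • p = 0 := congrArg Prod.snd h
    have hts : t - s ≠ 0 := sub_ne_zero.2 hst.symm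
    have h3 : (t - s) • q = 0 := by
      have : (t - s) • q = t • ((1 - s) • q + s • p) - s • ((1 - t) • q + t • p) := by module
      rw [this, h1, h2]; simp
    have h4 : (t - s) • p = 0 := by
      have : (t - s) • p = (1 - s) • ((1 - t) • q + t • p) - (1 - t) • ((1 - s) • q + s • p) := by
        module
      rw [this, h1, h2]; simp
    simp only [smul_eq_zero, hts, false_or] at h3 h4
    simp [h3, h4]
  have hg : (fun p : Conf d × Conf d =>
        ((AffineMap.lineMap p.1 p.2 s : Conf d), (AffineMap.lineMap p.1 p.2 t : Conf d))) =
      (LinearEquiv.ofInjectiveEndo f hf).toContinuousLinearEquiv := by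
    ext1 p
    simp [f, AffineMap.lineMap_apply_module]
  rw [hg, Measure.volume_eq_prod, Measure.addHaar_preimage_continuousLinearEquiv,
    ← Measure.volume_eq_prod, hH, mul_zero]

/-- A connected set of positive volume that no two-point link leaves (up to null sets) fills its
component. Otherwise expansiveness would give a non-null set of free segments that leave it, and
cutting these segments into pieces of length at most `ε` would give a non-null set of links. -/
theorem volume_connectedComponentIn_diff_eq_zero {α β δ : ℝ} (hF : IsClosed F)
    (hbdd : Bornology.IsBounded F) (hα : 0 < α) (hβ : 0 < β) (hε : 0 < ε)
    (hexp : IsExpansive F α β δ) {x : Conf d} (hx : x ∈ F) {S : Set (Conf d)}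
    (hSC : S ⊆ connectedComponentIn F x) (hSc : IsConnected S) (hSm : MeasurableSet S)
    (hS0 : volume S ≠ 0)
    (hnull : ∀ᵐ y, y ∉ S → ∀ᵐ q, q ∈ S → ¬ CanLink F ε q y) :
    volume (connectedComponentIn F x \ S) = 0 := by
  by_contra hne
  have hSF : S ⊆ F := hSC.trans (connectedComponentIn_subset F x)
  set L := lookout F (connectedComponentIn F x) β S with hL
  have hL0 : volume L ≠ 0 := by
    intro h0
    have := hexp.lookout_le x hx S hSC hSc hSm.nullMeasurableSet
    rw [← hL, h0, nonpos_iff_eq_zero, mul_eq_zero] at this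
    rcases this with h | h
    · exact absurd h (by simpa using hα)
    · exact hS0 h
  -- The links that leave `S`.
  let H : Set (Conf d × Conf d) := {p | p.1 ∈ S ∧ p.2 ∉ S ∧ CanLink F ε p.1 p.2}
  have hHm : MeasurableSet H :=
    (measurable_fst hSm).inter
      ((measurable_snd hSm.compl).inter (isClosed_canLink hF).measurableSet)
  have hH0 : (volume : Measure (Conf d × Conf d)) H = 0 := by
    rw [Measure.volume_eq_prod]
    have hae : ∀ᵐ q : Conf d, ∀ᵐ y : Conf d, (q, y) ∉ H := by
      refine (Measure.ae_ae_comm (p := fun q y => (q, y) ∉ H) hHm.compl).2 ?_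
      filter_upwards [hnull] with y hy
      by_cases hyS : y ∈ S
      · exact Eventually.of_forall fun q hq => hq.2.1 hyS
      · filter_upwards [hy hyS] with q hq hqH
        exact hq hqH.1 hqH.2.2
    rw [Measure.measure_prod_null hHm]
    filter_upwards [hae] with q hq
    exact measure_eq_zero_iff_ae_notMem.2 hq
  -- The free segments that leave `S`.
  let G : Set (Conf d × Conf d) := {p | p.1 ∈ S ∧ p.2 ∉ S ∧ segment ℝ p.1 p.2 ⊆ F}
  have hGm : MeasurableSet G :=
    (measurable_fst hSm).inter
      ((measurable_snd hSm.compl).inter (isClosed_segment_subset hF).measurableSet)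
  obtain ⟨N, hN⟩ := exists_nat_ge (Metric.diam F / ε)
  have hN1 : (0 : ℝ) < (N + 1 : ℕ) := by positivity
  have hdN : Metric.diam F / (N + 1 : ℕ) ≤ ε := by
    rw [div_le_iff₀ hN1]
    rw [div_le_iff₀ hε] at hN
    push_cast
    nlinarith
  let φ : ℕ → Conf d × Conf d → Conf d := fun j p =>
    AffineMap.lineMap p.1 p.2 ((j : ℝ) / (N + 1 : ℕ))
  have hGsub : G ⊆ ⋃ j : ℕ, (fun p => (φ j p, φ (j + 1) p)) ⁻¹' H := by
    rintro p ⟨hp1, hp2, hp3⟩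
    have h0 : φ 0 p ∈ S := by simpa [φ] using hp1
    have hlast : φ (N + 1) p ∉ S := by
      simpa only [φ, div_self hN1.ne', AffineMap.lineMap_apply_one] using hp2
    obtain ⟨j, hjN, hj, hj'⟩ : ∃ j, j < N + 1 ∧ φ j p ∈ S ∧ φ (j + 1) p ∉ S := by
      by_contra! hcon
      have : ∀ j, j ≤ N + 1 → φ j p ∈ S := by
        intro j
        induction j with
        | zero => exact fun _ => h0
        | succ j ih => exact fun hj => hcon j (by omega) (ih (by omega))
      exact hlast (this _ le_rfl)
    have hmem : ∀ i ≤ N + 1, φ i p ∈ segment ℝ p.1 p.2 := fun i hi => by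
      rw [segment_eq_image_lineMap]
      exact ⟨_, ⟨by positivity, (div_le_one hN1).2 (by exact_mod_cast hi)⟩, rfl⟩
    refine Set.mem_iUnion.2 ⟨j, hj, hj', ?_, ?_⟩
    · have hd : dist ((j : ℝ) / (N + 1 : ℕ)) (((j + 1 : ℕ) : ℝ) / (N + 1 : ℕ)) =
          1 / (N + 1 : ℕ) := by
        rw [Real.dist_eq, ← sub_div, abs_div, abs_of_pos hN1]
        push_cast
        norm_num
      simp only [φ, dist_lineMap_lineMap, hd]
      refine le_trans ?_ hdN
      rw [div_mul_eq_mul_div, one_mul]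
      gcongr
      exact Metric.dist_le_diam_of_mem hbdd (hSF hp1) (hp3 (right_mem_segment ℝ _ _))
    · exact ((convex_segment _ _).segment_subset (hmem j hjN.le) (hmem (j + 1) hjN)).trans hp3
  have hG0 : (volume : Measure (Conf d × Conf d)) G = 0 := by
    refine measure_mono_null hGsub (measure_iUnion_null fun j => ?_)
    refine volume_preimage_lineMap_prod (fun h => ?_) hH0
    rw [div_left_inj' hN1.ne'] at h
    norm_num at h
  rw [Measure.volume_eq_prod, Measure.measure_prod_null hGm] at hG0
  refine hL0 (measure_mono_null (fun q hq => ?_) (ae_iff.1 hG0))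
  have hsec : visibility F q \ S ⊆ Prod.mk q ⁻¹' G := fun p hp => ⟨hq.1, hp.2, hp.1.2⟩
  have hle := hq.2.trans (measure_mono hsec)
  intro h0
  rw [show volume (Prod.mk q ⁻¹' G) = 0 from h0] at hle
  simp only [nonpos_iff_eq_zero, mul_eq_zero, ENNReal.ofReal_eq_zero] at hle
  rcases hle with h | h
  · linarith
  · exact hne h

end Geometry

/-! ### Sequences of independent, identically distributed samples -/

section IID

variable {Ω E : Type*} [MeasurableSpace Ω] [MeasurableSpace E] {P : Measure Ω} {X : ℕ → Ω → E}

theorem indepFun_restrict_of_disjoint (hX : ∀ n, Measurable (X n)) (hind : iIndepFun X P)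
    {S T : Set ℕ} (hST : Disjoint S T) :
    IndepFun (fun ω (i : S) => X i ω) (fun ω (i : T) => X i ω) P := by
  have key : ∀ U : Set ℕ, MeasurableSpace.comap (fun ω (i : U) => X i ω) MeasurableSpace.pi ≤
      ⨆ i ∈ U, MeasurableSpace.comap (X i) inferInstance := fun U => by
    simp only [MeasurableSpace.pi, MeasurableSpace.comap_iSup, MeasurableSpace.comap_comp]
    exact iSup_le fun i =>
      le_iSup₂ (f := fun j (_ : j ∈ U) => MeasurableSpace.comap (X j) inferInstance) i.1 i.2
  rw [IndepFun_iff_Indep]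
  exact indep_of_indep_of_le_left (indep_of_indep_of_le_right
    (indep_iSup_of_disjoint (fun n => (hX n).comap_le) hind hST) (key T)) (key S)

theorem ae_of_indepFun [IsFiniteMeasure P] {A B : Type*} [MeasurableSpace A] [MeasurableSpace B]
    {Z : Ω → A} {Y : Ω → B} (hZ : Measurable Z) (hY : Measurable Y) (h : IndepFun Z Y P)
    {p : A → B → Prop} (hp : MeasurableSet {x : A × B | p x.1 x.2})
    (hall : ∀ z, ∀ᵐ ω ∂P, p z (Y ω)) : ∀ᵐ ω ∂P, p (Z ω) (Y ω) := by
  have hprod := (indepFun_iff_map_prod_eq_prod_map_map hZ.aemeasurable hY.aemeasurable).1 h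
  have hae : ∀ᵐ x ∂(P.map fun ω => (Z ω, Y ω)), p x.1 x.2 := by
    rw [hprod, Measure.ae_prod_iff_ae_ae hp]
    refine Eventually.of_forall fun z => ?_
    refine (ae_map_iff hY.aemeasurable (p := fun y => p z y)
      ((measurable_prodMk_left (x := z)) hp)).2 ?_
    exact hall z
  exact ae_of_ae_map (hZ.prodMk hY).aemeasurable hae

variable [IsProbabilityMeasure P] {ν : Measure E}

theorem ae_frequently_mem (hX : ∀ n, Measurable (X n)) (hind : iIndepFun X P)
    (hν : ∀ n, P.map (X n) = ν) {G : Set E} (hG : MeasurableSet G) (hG0 : ν G ≠ 0) :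
    ∀ᵐ ω ∂P, ∃ᶠ n in atTop, X n ω ∈ G := by
  have hPG : ∀ n, P (X n ⁻¹' G) = ν G := fun n => by rw [← hν n, Measure.map_apply (hX n) hG]
  have hs : iIndepSet (fun n => X n ⁻¹' G) P := by
    rw [iIndepSet_iff_meas_biInter fun n => hX n hG]
    exact fun s => hind.measure_inter_preimage_eq_mul s fun _ _ => hG
  have h1 := measure_limsup_eq_one (fun n => hX n hG) hs (by
    simp only [hPG]; exact ENNReal.tsum_const_eq_top_of_ne_zero hG0)
  have hm : MeasurableSet (limsup (fun n => X n ⁻¹' G) atTop) :=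
    MeasurableSet.measurableSet_limsup fun n => hX n hG
  filter_upwards [(prob_compl_eq_zero_iff hm).2 h1 |> measure_eq_zero_iff_ae_notMem.1] with ω hω
  rw [Set.notMem_compl_iff, mem_limsup_iff_frequently_mem] at hω
  exact hω

/-- A non-null set that depends on the first `N` samples only is hit by a later sample. -/
theorem ae_exists_ge_mem (hX : ∀ n, Measurable (X n)) (hind : iIndepFun X P)
    (hν : ∀ n, P.map (X n) = ν) [SFinite ν] (N : ℕ) {A : Type*} [MeasurableSpace A]
    {f : (Set.Iio N → E) → A} (hf : Measurable f) {B : Set (A × E)} (hB : MeasurableSet B) :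
    ∀ᵐ ω ∂P, ν (Prod.mk (f fun i => X i ω) ⁻¹' B) ≠ 0 →
      ∃ l ≥ N, (f (fun i => X i ω), X l ω) ∈ B := by
  let p : A → (Set.Ici N → E) → Prop := fun z y =>
    ν (Prod.mk z ⁻¹' B) ≠ 0 → ∃ i, (z, y i) ∈ B
  have hp : MeasurableSet {x : A × (Set.Ici N → E) | p x.1 x.2} := by
    have h1 : MeasurableSet {x : A × (Set.Ici N → E) | ν (Prod.mk x.1 ⁻¹' B) ≠ 0} :=
      ((measurable_measure_prodMk_left hB).comp measurable_fst) (measurableSet_singleton 0).compl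
    have h2 : MeasurableSet {x : A × (Set.Ici N → E) | ∃ i, (x.1, x.2 i) ∈ B} := by
      have : {x : A × (Set.Ici N → E) | ∃ i, (x.1, x.2 i) ∈ B} =
          ⋃ i, (fun x : A × (Set.Ici N → E) => (x.1, x.2 i)) ⁻¹' B := by
        ext x
        simp only [Set.mem_iUnion]
        rfl
      rw [this]
      exact MeasurableSet.iUnion fun i =>
        (measurable_fst.prodMk ((measurable_pi_apply i).comp measurable_snd)) hB
    exact h1.imp h2
  have hdisj : Disjoint (Set.Iio N) (Set.Ici N) := Set.Iio_disjoint_Ici le_rfl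
  have hXS : ∀ S : Set ℕ, Measurable (fun ω (i : S) => X i ω) := fun S =>
    measurable_pi_iff.2 fun i => hX i
  have := ae_of_indepFun (p := p) (hf.comp (hXS (Set.Iio N))) (hXS (Set.Ici N))
    ((indepFun_restrict_of_disjoint hX hind hdisj).comp hf measurable_id) hp fun z => by
      by_cases h0 : ν (Prod.mk z ⁻¹' B) = 0
      · exact Eventually.of_forall fun ω h => absurd h0 h
      · filter_upwards [ae_frequently_mem hX hind hν (measurable_prodMk_left hB) h0] with ω hω _
        obtain ⟨n, hn, hn'⟩ := frequently_atTop.1 hω N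
        exact ⟨⟨n, hn⟩, hn'⟩
  filter_upwards [this] with ω hω h0
  obtain ⟨i, hi⟩ := hω h0
  exact ⟨i, i.2, hi⟩

/-- If almost every point is related to a proportion at least `c > 0` of all points, then all but
finitely many samples are related to an earlier sample: the probability that the `n`-th sample is
not is at most `(1 - c) ^ n`. -/
theorem ae_eventually_exists_lt_mem (hX : ∀ n, Measurable (X n)) (hind : iIndepFun X P)
    (hν : ∀ n, P.map (X n) = ν) {B : Set (E × E)} (hB : MeasurableSet B) {c : ENNReal}
    (hc : c ≠ 0) (hBc : ∀ᵐ z ∂ν, c ≤ ν (Prod.mk z ⁻¹' B)) :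
    ∀ᵐ ω ∂P, ∀ᶠ n in atTop, ∃ m < n, (X n ω, X m ω) ∈ B := by
  have : IsProbabilityMeasure ν := by
    rw [← hν 0]; exact Measure.isProbabilityMeasure_map (hX 0).aemeasurable
  let bad : ∀ n : ℕ, Set Ω := fun n => {ω | ∀ m < n, (X n ω, X m ω) ∉ B}
  have hbound : ∀ n, P (bad n) ≤ (1 - c) ^ n := by
    intro n
    let S : Finset ℕ := {n}
    let T : Finset ℕ := Finset.range n
    have hXn := hX n
    have hY : Measurable (fun ω (i : T) => X i ω) := measurable_pi_iff.2 fun i => hX i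
    have hindep : IndepFun (X n) (fun ω (i : T) => X i ω) P :=
      (hind.indepFun_finset S T (by simp [S, T]) hX).comp
        (φ := fun z : S → E => z ⟨n, Finset.mem_singleton_self n⟩)
        (ψ := fun y : T → E => y) (measurable_pi_apply _) measurable_id
    have hprod := (indepFun_iff_map_prod_eq_prod_map_map hXn.aemeasurable hY.aemeasurable).1 hindep
    let C : Set (E × (T → E)) := ⋂ i : T, (fun x : E × (T → E) => (x.1, x.2 i)) ⁻¹' Bᶜ
    have hC : MeasurableSet C := MeasurableSet.iInter fun i =>
      (measurable_fst.prodMk ((measurable_pi_apply i).comp measurable_snd)) hB.compl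
    have hbad : bad n = (fun ω => (X n ω, fun i : T => X i ω)) ⁻¹' C := by
      ext ω
      simp [bad, C, T]
    rw [hbad, ← Measure.map_apply (hXn.prodMk hY) hC, hprod, Measure.prod_apply hC, hν n]
    calc _ ≤ ∫⁻ _, (1 - c) ^ n ∂ν := by
          refine lintegral_mono_ae ?_
          filter_upwards [hBc] with z hz
          have hBz : MeasurableSet (Prod.mk z ⁻¹' B) := measurable_prodMk_left hB
          rw [Measure.map_apply hY (measurable_prodMk_left hC)]
          have : (fun ω (i : T) => X i ω) ⁻¹' (Prod.mk z ⁻¹' C) =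
              ⋂ i ∈ T, X i ⁻¹' (Prod.mk z ⁻¹' B)ᶜ := by
            ext ω
            simp [C, T]
          rw [this, hind.measure_inter_preimage_eq_mul T (fun _ _ => hBz.compl)]
          calc _ = ∏ _i ∈ T, (1 - ν (Prod.mk z ⁻¹' B)) := by
                refine Finset.prod_congr rfl fun i _ => ?_
                rw [← Measure.map_apply (hX i) hBz.compl, hν i, prob_compl_eq_one_sub hBz]
            _ = (1 - ν (Prod.mk z ⁻¹' B)) ^ n := by simp [T]
            _ ≤ _ := by gcongr
      _ = _ := by simp
  have hsum : ∑' n, P (bad n) ≠ ⊤ := by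
    refine ne_top_of_le_ne_top ?_ (ENNReal.tsum_le_tsum hbound)
    rw [ENNReal.tsum_geometric, ne_eq, ENNReal.inv_eq_top]
    exact (tsub_pos_of_lt (ENNReal.sub_lt_self ENNReal.one_ne_top one_ne_zero hc)).ne'
  filter_upwards [ae_eventually_notMem hsum] with ω hω
  filter_upwards [hω] with n hn
  simpa [bad] using hn

end IID

/-! ### The graph of links between the samples -/

section SampleGraph

variable {d : ℕ} {F : Set (Conf d)} {ε : ℝ} {k : ℕ}

/-- The samples `i` and `j` can be linked, and they are not both among the first `k`. The first `k`
samples start the arms, and the planner does not look for links between them. -/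
def SampleLink (F : Set (Conf d)) (ε : ℝ) (k : ℕ) (x : ℕ → Conf d) (i j : ℕ) : Prop :=
  CanLink F ε (x i) (x j) ∧ (k ≤ i ∨ k ≤ j)

/-- The union of the sets reached by the samples of one class of the link graph is connected. -/
theorem isConnected_iUnion_reach (hε : 0 ≤ ε) {x : ℕ → Conf d} (hx : ∀ n, x n ∈ F) (n : ℕ) :
    IsConnected (⋃ m ∈ {m | Relation.ReflTransGen (SampleLink F ε k x) n m},
      reach F ε (x m)) := by
  set S := ⋃ m ∈ {m | Relation.ReflTransGen (SampleLink F ε k x) n m},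
      reach F ε (x m) with hS
  have hsub : ∀ m, Relation.ReflTransGen (SampleLink F ε k x) n m →
      reach F ε (x m) ⊆ S := fun m hm =>
    Set.subset_biUnion_of_mem (u := fun m => reach F ε (x m)) hm
  have hself : ∀ m, x m ∈ reach F ε (x m) := fun m => canLink_self hε (hx m)
  have key : ∀ m, Relation.ReflTransGen (SampleLink F ε k x) n m →
      ∃ t ⊆ S, IsPreconnected t ∧ x n ∈ t ∧ reach F ε (x m) ⊆ t := by
    intro m hm
    induction hm with
    | refl => exact ⟨_, hsub n .refl, (isConnected_reach hε (hx n)).isPreconnected, hself n, le_rfl⟩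
    | @tail m m' hm hlink ih =>
      obtain ⟨t, htS, ht, hnt, hmt⟩ := ih
      exact ⟨t ∪ reach F ε (x m'), Set.union_subset htS (hsub m' (hm.tail hlink)),
        ht.union (x m') (hmt hlink.1) (hself m') (isConnected_reach hε (hx m')).isPreconnected,
        Or.inl hnt, Set.subset_union_right⟩
  refine ⟨⟨x n, hsub n .refl (hself n)⟩, isPreconnected_of_forall (x n) fun y hy => ?_⟩
  obtain ⟨m, hm, hy⟩ := Set.mem_iUnion₂.1 hy
  obtain ⟨t, htS, ht, hnt, hmt⟩ := key m hm
  exact ⟨t, htS, hnt, hmt hy, ht⟩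

/-- The deterministic half of the connectedness of the link graph: a class of samples fills its
component by expansiveness, so the sets reached by two samples of one component overlap, up to
steps inside the first class. -/
theorem reflTransGen_canLink_of_connectedComponentIn_eq {α β δ : ℝ} (hF : IsClosed F)
    (hbdd : Bornology.IsBounded F) (hα : 0 < α) (hβ : 0 < β) (hε : 0 < ε)
    (hexp : IsExpansive F α β δ) (hpos : ∀ z ∈ F, volume (reach F ε z) ≠ 0)
    {x : ℕ → Conf d} (hx : ∀ n, x n ∈ F)
    (hpair : ∀ n m, volume (reach F ε (x n) ∩ reach F ε (x m)) ≠ 0 →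
      ∃ l ≥ k, x l ∈ reach F ε (x n) ∩ reach F ε (x m))
    (hpoint : ∀ n, ∀ᵐ y, volume (reach F ε (x n) ∩ reach F ε y) ≠ 0 →
      ∃ l ≥ k, x l ∈ reach F ε (x n) ∩ reach F ε y)
    {n m : ℕ} (hnm : connectedComponentIn F (x n) = connectedComponentIn F (x m)) :
    Relation.ReflTransGen (SampleLink F ε k x) n m := by
  let A : Set ℕ := {m | Relation.ReflTransGen (SampleLink F ε k x) n m}
  let S : Set (Conf d) := ⋃ m ∈ A, reach F ε (x m)
  have hcomp : ∀ m ∈ A, connectedComponentIn F (x n) = connectedComponentIn F (x m) := by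
    intro m hm
    induction hm with
    | refl => rfl
    | tail _ h ih => exact ih.trans h.1.connectedComponentIn_eq
  have hfull : volume (connectedComponentIn F (x n) \ S) = 0 := by
    refine volume_connectedComponentIn_diff_eq_zero hF hbdd hα hβ hε hexp (hx n) ?_
      (isConnected_iUnion_reach hε.le hx n) ?_ ?_ ?_
    · refine Set.iUnion₂_subset fun m hm => ?_
      rw [hcomp m hm]
      exact reach_subset_connectedComponentIn (x m)
    · exact MeasurableSet.biUnion (Set.to_countable A) fun m _ =>
        (isClosed_reach hF _).measurableSet
    · have hn : n ∈ A := Relation.ReflTransGen.refl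
      exact fun h0 => hpos _ (hx n) (measure_mono_null
        (Set.subset_biUnion_of_mem (u := fun m => reach F ε (x m)) hn) h0)
    · filter_upwards [ae_all_iff.2 hpoint] with y hy hyS
      have hzero : ∀ m ∈ A, volume (reach F ε (x m) ∩ reach F ε y) = 0 := by
        intro m hm
        by_contra h0
        obtain ⟨l, hkl, hl⟩ := hy m h0
        exact hyS (Set.mem_biUnion (show l ∈ A from hm.tail ⟨hl.1, Or.inr hkl⟩)
          (CanLink.symm hl.2))
      have hall : ∀ᵐ q, ∀ m ∈ A, q ∉ reach F ε (x m) ∩ reach F ε y :=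
        (ae_ball_iff (Set.to_countable A)).2 fun m hm =>
          measure_eq_zero_iff_ae_notMem.1 (hzero m hm)
      filter_upwards [hall] with q hq hqS hlink
      obtain ⟨m, hm, hqm⟩ := Set.mem_iUnion₂.1 hqS
      exact hq m hm ⟨hqm, hlink.symm⟩
  obtain ⟨n', hn', h0⟩ : ∃ n' ∈ A, volume (reach F ε (x n') ∩ reach F ε (x m)) ≠ 0 := by
    by_contra! hcon
    have hnull : volume (⋃ n' ∈ A, reach F ε (x n') ∩ reach F ε (x m)) = 0 :=
      (measure_biUnion_null_iff (Set.to_countable A)).2 hcon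
    refine hpos _ (hx m) (measure_mono_null (fun q hq => ?_) (measure_union_null hfull hnull))
    by_cases hqS : q ∈ S
    · obtain ⟨n', hn', hqn'⟩ := Set.mem_iUnion₂.1 hqS
      exact Or.inr (Set.mem_biUnion hn' ⟨hqn', hq⟩)
    · refine Or.inl ⟨?_, hqS⟩
      rw [hnm]
      exact reach_subset_connectedComponentIn _ hq
  obtain ⟨l, hkl, hl⟩ := hpair n' m h0
  exact (Relation.ReflTransGen.tail hn' ⟨hl.1, Or.inr hkl⟩).tail
    ⟨CanLink.symm hl.2, Or.inl hkl⟩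

variable {Ω : Type*} [MeasurableSpace Ω] {P : Measure Ω} [IsProbabilityMeasure P]
  {X : ℕ → Ω → Conf d}

/-- The properties of the sequence of samples on which the correctness of the planner rests. Apart
from them, the sequence and all the choices of the planner may be arbitrary. -/
structure GoodSamples (F : Set (Conf d)) (ε : ℝ) (qInit : Conf d) (k : ℕ) (x : ℕ → Conf d) :
    Prop where
  mem : ∀ n, x n ∈ F
  connected : ∀ n m, connectedComponentIn F (x n) = connectedComponentIn F (x m) →
    Relation.ReflTransGen (SampleLink F ε k x) n m
  eventually_link : ∀ᶠ n in atTop, ∃ m < n, CanLink F ε (x m) (x n)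
  root_link : ∃ l ≥ k, CanLink F ε qInit (x l)
  exists_mem_component : ∀ z ∈ F, ∃ n, x n ∈ connectedComponentIn F z

theorem ae_goodSamples {α β δ : ℝ} (hF : IsClosed F)
    (hbdd : Bornology.IsBounded F) (hα : 0 < α) (hβ : 0 < β) (hδ : 0 < δ) (hε : 0 < ε)
    (hexp : IsExpansive F α β δ) {qInit : Conf d} (hq : qInit ∈ F) (k : ℕ)
    (hX : ∀ n, Measurable (X n)) (hind : iIndepFun X P)
    (hunif : ∀ n, pdf.IsUniform (X n) F P volume) :
    ∀ᵐ ω ∂P, GoodSamples F ε qInit k (fun n => X n ω) := by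
  have hvis : ∀ z ∈ F, ENNReal.ofReal δ ≤ volume (visibility F z) := fun z hz =>
    hexp.good z hz z (mem_connectedComponentIn hz)
  obtain ⟨c, hc, hreach⟩ := exists_pos_forall_le_volume_reach hbdd hε hδ hvis
  have hpos : ∀ z ∈ F, volume (reach F ε z) ≠ 0 := fun z hz => (hc.trans_le (hreach z hz)).ne'
  have hFm : MeasurableSet F := hF.measurableSet
  have hFtop : volume F ≠ ⊤ := hbdd.measure_lt_top.ne
  have hFinv : (volume F)⁻¹ ≠ 0 := ENNReal.inv_ne_zero.2 hFtop
  have hνG : ∀ G ⊆ F, (volume[|F] : Measure (Conf d)) G = (volume F)⁻¹ * volume G := fun G hG => by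
    rw [cond_apply hFm, Set.inter_eq_self_of_subset_right hG]
  have hν0 : ∀ G ⊆ F, volume G ≠ 0 → (volume[|F] : Measure (Conf d)) G ≠ 0 := fun G hG h0 => by
    rw [hνG G hG]
    exact mul_ne_zero hFinv h0
  have hmem : ∀ᵐ ω ∂P, ∀ n, X n ω ∈ F := by
    refine ae_all_iff.2 fun n => ae_of_ae_map (hX n).aemeasurable (p := fun z => z ∈ F) ?_
    rw [show P.map (X n) = volume[|F] from hunif n]
    exact ae_cond_mem hFm
  -- Pairs of points together with a point to which both can be linked.
  let B : Set ((Conf d × Conf d) × Conf d) :=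
    {p | CanLink F ε p.1.1 p.2 ∧ CanLink F ε p.1.2 p.2}
  have hB : MeasurableSet B := by
    have h1 := (isClosed_canLink (ε := ε) hF).preimage
      (f := fun p : (Conf d × Conf d) × Conf d => (p.1.1, p.2)) (by fun_prop)
    have h2 := (isClosed_canLink (ε := ε) hF).preimage
      (f := fun p : (Conf d × Conf d) × Conf d => (p.1.2, p.2)) (by fun_prop)
    exact (h1.inter h2).measurableSet
  have hBsub : ∀ z : Conf d × Conf d, Prod.mk z ⁻¹' B ⊆ F := fun z e he => he.1.right_mem
  have key : ∀ (N : ℕ) (f : (Set.Iio N → Conf d) → Conf d × Conf d), Measurable f →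
      ∀ᵐ ω ∂P, volume (Prod.mk (f fun i => X i ω) ⁻¹' B) ≠ 0 →
        ∃ l ≥ N, (f (fun i => X i ω), X l ω) ∈ B := by
    intro N f hf
    filter_upwards [ae_exists_ge_mem hX hind hunif N hf hB] with ω hω h0
    exact hω (hν0 _ (hBsub _) h0)
  have hpair : ∀ᵐ ω ∂P, ∀ n m, volume (reach F ε (X n ω) ∩ reach F ε (X m ω)) ≠ 0 →
      ∃ l ≥ k, X l ω ∈ reach F ε (X n ω) ∩ reach F ε (X m ω) := by
    refine ae_all_iff.2 fun n => ae_all_iff.2 fun m => ?_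
    filter_upwards [key (max k (max n m + 1))
      (fun z => (z ⟨n, by simp⟩, z ⟨m, by simp⟩))
      ((measurable_pi_apply _).prodMk (measurable_pi_apply _))] with ω hω h0
    obtain ⟨l, hkl, hl⟩ := hω h0
    exact ⟨l, le_of_max_le_left hkl, hl⟩
  have hpoint : ∀ᵐ ω ∂P, ∀ n, ∀ᵐ y, volume (reach F ε (X n ω) ∩ reach F ε y) ≠ 0 →
      ∃ l ≥ k, X l ω ∈ reach F ε (X n ω) ∩ reach F ε y := by
    refine ae_all_iff.2 fun n => ?_
    have hm : MeasurableSet {p : Ω × Conf d |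
        volume (reach F ε (X n p.1) ∩ reach F ε p.2) ≠ 0 →
          ∃ l ≥ k, X l p.1 ∈ reach F ε (X n p.1) ∩ reach F ε p.2} := by
      have hg : Measurable fun p : Ω × Conf d => (X n p.1, p.2) :=
        ((hX n).comp measurable_fst).prodMk measurable_snd
      have h1 : MeasurableSet {p : Ω × Conf d |
          volume (reach F ε (X n p.1) ∩ reach F ε p.2) ≠ 0} :=
        ((measurable_measure_prodMk_left hB).comp hg) (measurableSet_singleton 0).compl
      have h2 : MeasurableSet {p : Ω × Conf d |
          ∃ l ≥ k, X l p.1 ∈ reach F ε (X n p.1) ∩ reach F ε p.2} := by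
        have : {p : Ω × Conf d | ∃ l ≥ k, X l p.1 ∈ reach F ε (X n p.1) ∩ reach F ε p.2} =
            ⋃ l ≥ k, (fun p : Ω × Conf d => ((X n p.1, p.2), X l p.1)) ⁻¹' B := by
          ext p
          simp only [Set.mem_iUnion, exists_prop]
          rfl
        rw [this]
        exact MeasurableSet.iUnion fun l => MeasurableSet.iUnion fun _ =>
          (hg.prodMk ((hX l).comp measurable_fst)) hB
      exact h1.imp h2
    refine (Measure.ae_ae_comm (p := fun ω y => volume (reach F ε (X n ω) ∩ reach F ε y) ≠ 0 →
      ∃ l ≥ k, X l ω ∈ reach F ε (X n ω) ∩ reach F ε y) hm).2 (Eventually.of_forall fun y => ?_)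
    filter_upwards [key (max k (n + 1)) (fun z => (z ⟨n, by simp⟩, y))
      ((measurable_pi_apply _).prodMk measurable_const)] with ω hω h0
    obtain ⟨l, hkl, hl⟩ := hω h0
    exact ⟨l, le_of_max_le_left hkl, hl⟩
  have hfix : ∀ y ∈ F, ∀ᵐ ω ∂P, ∃ l ≥ k, CanLink F ε y (X l ω) := by
    intro y hy
    filter_upwards [key k (fun _ => (y, y)) measurable_const] with ω hω
    obtain ⟨l, hl, hlB⟩ := hω (by
      rw [show Prod.mk (y, y) ⁻¹' B = reach F ε y from Set.inter_self _]
      exact hpos y hy)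
    exact ⟨l, hl, hlB.1⟩
  have hcover : ∀ᵐ ω ∂P, ∀ᵐ y, y ∈ F → ∃ l, CanLink F ε y (X l ω) := by
    have hm : MeasurableSet {p : Ω × Conf d | p.2 ∈ F → ∃ l, CanLink F ε p.2 (X l p.1)} := by
      have h2 : MeasurableSet {p : Ω × Conf d | ∃ l, CanLink F ε p.2 (X l p.1)} := by
        have : {p : Ω × Conf d | ∃ l, CanLink F ε p.2 (X l p.1)} =
            ⋃ l, (fun p : Ω × Conf d => (p.2, X l p.1)) ⁻¹' {p | CanLink F ε p.1 p.2} := by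
          ext p
          simp only [Set.mem_iUnion]
          rfl
        rw [this]
        exact MeasurableSet.iUnion fun l =>
          (measurable_snd.prodMk ((hX l).comp measurable_fst)) (isClosed_canLink hF).measurableSet
      exact (measurable_snd hFm).imp h2
    refine (Measure.ae_ae_comm (p := fun ω y => y ∈ F → ∃ l, CanLink F ε y (X l ω)) hm).2
      (Eventually.of_forall fun y => ?_)
    by_cases hy : y ∈ F
    · filter_upwards [hfix y hy] with ω ⟨l, _, hl⟩ _
      exact ⟨l, hl⟩
    · exact Eventually.of_forall fun _ h => absurd h hy
  have hlink : ∀ᵐ ω ∂P, ∀ᶠ n in atTop, ∃ m < n, CanLink F ε (X n ω) (X m ω) :=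
    ae_eventually_exists_lt_mem hX hind hunif (isClosed_canLink hF).measurableSet
      (mul_ne_zero hFinv hc.ne') (by
        filter_upwards [ae_cond_mem hFm] with z hz
        rw [show Prod.mk z ⁻¹' {p : Conf d × Conf d | CanLink F ε p.1 p.2} = reach F ε z from rfl,
          hνG _ (reach_subset z)]
        gcongr
        exact hreach z hz)
  filter_upwards [hmem, hpair, hpoint, hfix qInit hq, hcover, hlink]
    with ω hmem hpair hpoint hroot hcover hlink
  refine ⟨hmem, fun n m => reflTransGen_canLink_of_connectedComponentIn_eq hF hbdd hα hβ hε hexp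
    hpos hmem hpair hpoint, ?_, hroot, fun z hz => ?_⟩
  · filter_upwards [hlink] with n ⟨m, hm, h⟩
    exact ⟨m, hm, h.symm⟩
  · obtain ⟨y, hyC, hy⟩ : ∃ y ∈ connectedComponentIn F z, y ∈ F → ∃ l, CanLink F ε y (X l ω) := by
      by_contra! hcon
      refine hpos z hz (measure_mono_null (fun y hy => ?_) (ae_iff.1 hcover))
      have := hcon y (reach_subset_connectedComponentIn z hy)
      simpa using this
    obtain ⟨l, hl⟩ := hy (connectedComponentIn_subset F z hyC)
    refine ⟨l, ?_⟩
    rw [connectedComponentIn_eq hyC]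
    exact reach_subset_connectedComponentIn y hl

end SampleGraph

/-! ### Adding a point to a set of d-trees -/

section AddPoint

variable {d : ℕ} {F : Set (Conf d)} {ε : ℝ} {qInit q : Conf d} {D D' : Set (DTree d)}

/-- Only the vertex sets of the trees matter in what follows, so rewiring plays no role. -/
theorem AddPoint.exists_verts_eq (h : AddPoint F ε qInit D q D') :
    ∃ T₂ : DTree d, T₂.verts = insert q (⋃ T ∈ joinable F ε D q, T.verts) ∧
      D' = insert T₂ (D \ joinable F ε D q) := by
  obtain ⟨T₁, T₂, hjoin, hT₂, hD'⟩ := h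
  refine ⟨T₂, ?_, hD'⟩
  rcases hT₂ with rfl | ⟨_, hrew⟩
  · exact hjoin.1
  · rw [hrew.1, hjoin.1]

theorem AddPoint.exists_verts_subset (h : AddPoint F ε qInit D q D') {T : DTree d} (hT : T ∈ D) :
    ∃ T' ∈ D', T.verts ⊆ T'.verts := by
  obtain ⟨T₂, hv, rfl⟩ := h.exists_verts_eq
  by_cases hJ : T ∈ joinable F ε D q
  · refine ⟨T₂, Set.mem_insert _ _, ?_⟩
    rw [hv]
    exact (Set.subset_biUnion_of_mem (u := fun T : DTree d => T.verts) hJ).trans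
      (Set.subset_insert _ _)
  · exact ⟨T, Or.inr ⟨hT, hJ⟩, le_rfl⟩

/-- The tree of the added point contains all nodes to which this point can be linked. -/
theorem AddPoint.exists_mem (h : AddPoint F ε qInit D q D') :
    ∃ T' ∈ D', q ∈ T'.verts ∧ ∀ T ∈ D, ∀ v ∈ T.verts, CanLink F ε v q → v ∈ T'.verts := by
  obtain ⟨T₂, hv, rfl⟩ := h.exists_verts_eq
  refine ⟨T₂, Set.mem_insert _ _, by simp [hv], fun T hT v hvT hlink => ?_⟩
  rw [hv]
  exact Or.inr (Set.mem_biUnion (show T ∈ joinable F ε D q from ⟨hT, v, hvT, hlink⟩) hvT)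

/-- Each tree extends an old one, unless it is a new tree at a point that was joined to none. -/
theorem AddPoint.exists_subset_verts (h : AddPoint F ε qInit D q D') {T' : DTree d}
    (hT' : T' ∈ D') :
    (∃ T ∈ D, T.verts ⊆ T'.verts) ∨ (joinable F ε D q = ∅ ∧ q ∈ T'.verts) := by
  obtain ⟨T₂, hv, rfl⟩ := h.exists_verts_eq
  rcases hT' with rfl | hT'
  · rcases (joinable F ε D q).eq_empty_or_nonempty with h0 | ⟨T, hT⟩
    · exact Or.inr ⟨h0, by simp [hv]⟩
    · refine Or.inl ⟨T, hT.1, ?_⟩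
      rw [hv]
      exact (Set.subset_biUnion_of_mem (u := fun T : DTree d => T.verts) hT).trans
        (Set.subset_insert _ _)
  · exact Or.inl ⟨T', hT'.1, le_rfl⟩

end AddPoint

/-- The invariants of the set of d-trees: there are finitely many of them, they are non-empty, they
are pairwise disjoint, and each of them lies in one connected component of `F`. -/
structure IsForest {d : ℕ} (F : Set (Conf d)) (D : Set (DTree d)) : Prop where
  finite : D.Finite
  nonempty : ∀ T ∈ D, T.verts.Nonempty
  eq_of_mem : ∀ T ∈ D, ∀ T' ∈ D, ∀ u, u ∈ T.verts → u ∈ T'.verts → T = T'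
  component : ∀ T ∈ D, ∀ u ∈ T.verts, T.verts ⊆ connectedComponentIn F u

theorem IsForest.addPoint {d : ℕ} {F : Set (Conf d)} {ε : ℝ} {qInit q : Conf d}
    {D D' : Set (DTree d)} (hD : IsForest F D) (hε : 0 ≤ ε) (hq : q ∈ F)
    (h : AddPoint F ε qInit D q D') : IsForest F D' := by
  obtain ⟨T₂, hv, rfl⟩ := h.exists_verts_eq
  have hmem : ∀ u ∈ T₂.verts, u = q ∨ ∃ T ∈ joinable F ε D q, u ∈ T.verts := fun u hu => by
    rw [hv] at hu
    simpa using hu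
  have hnot : ∀ T ∈ D \ joinable F ε D q, ∀ u ∈ T.verts, u ∉ T₂.verts := by
    intro T hT u huT hu
    rcases hmem u hu with rfl | ⟨T', hT', huT'⟩
    · exact hT.2 ⟨hT.1, u, huT, canLink_self hε hq⟩
    · exact hT.2 (hD.eq_of_mem T hT.1 T' hT'.1 u huT huT' ▸ hT')
  have hcomp : ∀ u ∈ T₂.verts, u ∈ connectedComponentIn F q := by
    intro u hu
    rcases hmem u hu with rfl | ⟨T', ⟨hT', v, hvT', hlink⟩, huT'⟩
    · exact mem_connectedComponentIn hq
    · rw [← hlink.connectedComponentIn_eq]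
      exact hD.component T' hT' v hvT' huT'
  refine ⟨(hD.finite.subset Set.sdiff_subset).insert _, ?_, ?_, ?_⟩
  · rintro T (rfl | hT)
    · exact ⟨q, by simp [hv]⟩
    · exact hD.nonempty T hT.1
  · rintro T (rfl | hT) T' (rfl | hT') u hu hu'
    · rfl
    · exact absurd hu (hnot T' hT' u hu')
    · exact absurd hu' (hnot T hT u hu)
    · exact hD.eq_of_mem T hT.1 T' hT'.1 u hu hu'
  · rintro T (rfl | hT) u hu
    · rw [← connectedComponentIn_eq (hcomp u hu)]
      exact hcomp
    · exact hD.component T hT.1 u hu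

/-! ### Trajectories of the planner -/

/-- What is used of one run of the planner, for a fixed outcome: `x` is the sequence of samples,
`ρ` the predicate of the iterations that are spent on restarts, and `st` the sequence of states. -/
structure IsTrajectory {d k : ℕ} (F : Set (Conf d)) (ε : ℝ) (qInit : Conf d) (x : ℕ → Conf d)
    (ρ : ℕ → Prop) (st : ℕ → State d k) : Prop where
  init : st 0 = initState qInit (fun i : Fin k => x i)
  restart : ∀ t, ρ t → ∃ i, RestartStep F ε qInit (st t) i
    (x (k + {s | s < t ∧ ρ s}.ncard)) (st (t + 1))
  localStep : ∀ t, ¬ ρ t → ∃ i q, dist ((st t).pos i) q ≤ ε ∧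
    LocalStep F ε qInit (st t) i q (st (t + 1))
  infinite : {t | ρ t}.Infinite

namespace IsTrajectory

variable {d k : ℕ} {F : Set (Conf d)} {ε : ℝ} {qInit : Conf d} {x : ℕ → Conf d}
  {ρ : ℕ → Prop} {st : ℕ → State d k}

/-- The nodes `u` and `v` belong to one d-tree at time `t`. -/
def Together (st : ℕ → State d k) (t : ℕ) (u v : Conf d) : Prop :=
  ∃ T ∈ (st t).trees, u ∈ T.verts ∧ v ∈ T.verts

theorem ncard_eq_count [DecidablePred ρ] (t : ℕ) : {s | s < t ∧ ρ s}.ncard = Nat.count ρ t := by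
  rw [Nat.count_eq_card_filter_range, ← Set.ncard_coe_finset]
  congr 1
  ext s
  simp

theorem exists_verts_subset_succ (h : IsTrajectory F ε qInit x ρ st) (t : ℕ) {T : DTree d}
    (hT : T ∈ (st t).trees) : ∃ T' ∈ (st (t + 1)).trees, T.verts ⊆ T'.verts := by
  by_cases hρ : ρ t
  · obtain ⟨i, hadd, -⟩ := h.restart t hρ
    exact hadd.exists_verts_subset hT
  · obtain ⟨i, q, -, hloc⟩ := h.localStep t hρ
    by_cases hseg : segment ℝ ((st t).pos i) q ⊆ F
    · exact (hloc.1 hseg).1.exists_verts_subset hT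
    · exact ⟨T, by rwa [hloc.2 hseg], le_rfl⟩

theorem exists_verts_subset (h : IsTrajectory F ε qInit x ρ st) {t s : ℕ} (hts : t ≤ s)
    {T : DTree d} (hT : T ∈ (st t).trees) : ∃ T' ∈ (st s).trees, T.verts ⊆ T'.verts := by
  induction s, hts using Nat.le_induction with
  | base => exact ⟨T, hT, le_rfl⟩
  | succ s _ ih =>
    obtain ⟨T', hT', hsub⟩ := ih
    obtain ⟨T'', hT'', hsub'⟩ := h.exists_verts_subset_succ s hT'
    exact ⟨T'', hT'', hsub.trans hsub'⟩

theorem together_mono (h : IsTrajectory F ε qInit x ρ st) {t s : ℕ} (hts : t ≤ s) {u v : Conf d}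
    (huv : Together st t u v) : Together st s u v := by
  obtain ⟨T, hT, hu, hv⟩ := huv
  obtain ⟨T', hT', hsub⟩ := h.exists_verts_subset hts hT
  exact ⟨T', hT', hsub hu, hsub hv⟩

theorem exists_pos_mem (h : IsTrajectory F ε qInit x ρ st) (t : ℕ) (i : Fin k) :
    ∃ T ∈ (st t).trees, (st t).pos i ∈ T.verts := by
  induction t with
  | zero =>
    rw [h.init]
    exact ⟨DTree.single (x i), Or.inr ⟨i, rfl⟩, rfl⟩
  | succ t ih =>
    have hold : ∃ T ∈ (st (t + 1)).trees, (st t).pos i ∈ T.verts := by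
      obtain ⟨T, hT, hi⟩ := ih
      obtain ⟨T', hT', hsub⟩ := h.exists_verts_subset_succ t hT
      exact ⟨T', hT', hsub hi⟩
    have hupd : ∀ j q, AddPoint F ε qInit (st t).trees q (st (t + 1)).trees →
        (st (t + 1)).pos = Function.update (st t).pos j q →
        ∃ T ∈ (st (t + 1)).trees, (st (t + 1)).pos i ∈ T.verts := by
      intro j q hadd hpos
      rw [hpos]
      by_cases hij : i = j
      · subst hij
        obtain ⟨T', hT', hq, -⟩ := hadd.exists_mem
        exact ⟨T', hT', by simpa using hq⟩
      · simpa [Function.update_of_ne hij] using hold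
    by_cases hρ : ρ t
    · obtain ⟨j, hadd, hnew, hsame⟩ := h.restart t hρ
      rcases Set.eq_empty_or_nonempty (joinable F ε (st t).trees
        (x (k + {s | s < t ∧ ρ s}.ncard))) with h0 | h0
      · exact hupd j _ hadd (hnew h0)
      · rwa [hsame h0]
    · obtain ⟨j, q, -, hloc⟩ := h.localStep t hρ
      by_cases hseg : segment ℝ ((st t).pos j) q ⊆ F
      · exact hupd j q (hloc.1 hseg).1 (hloc.1 hseg).2
      · rwa [hloc.2 hseg] at hold ⊢

/-- A local step never creates a new tree, since it starts from a node. -/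
theorem joinable_nonempty_of_localStep (h : IsTrajectory F ε qInit x ρ st) {t : ℕ} {i : Fin k}
    {q : Conf d} (hdist : dist ((st t).pos i) q ≤ ε) (hseg : segment ℝ ((st t).pos i) q ⊆ F) :
    (joinable F ε (st t).trees q).Nonempty := by
  obtain ⟨T, hT, hi⟩ := h.exists_pos_mem t i
  exact ⟨T, hT, _, hi, hdist, hseg⟩

theorem isForest (h : IsTrajectory F ε qInit x ρ st) (hε : 0 ≤ ε) (hq : qInit ∈ F)
    (hx : ∀ n, x n ∈ F) (t : ℕ) : IsForest F (st t).trees := by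
  induction t with
  | zero =>
    rw [h.init]
    have hsingle : ∀ T ∈ (initState qInit (fun i : Fin k => x i)).trees,
        ∃ z ∈ F, T = DTree.single z := by
      rintro T (rfl | ⟨i, rfl⟩)
      exacts [⟨qInit, hq, rfl⟩, ⟨x i, hx i, rfl⟩]
    refine ⟨(Set.finite_range _).insert _, fun T hT => ?_, fun T hT T' hT' u hu hu' => ?_,
      fun T hT u hu v hv => ?_⟩
    · obtain ⟨z, -, rfl⟩ := hsingle T hT
      exact ⟨z, rfl⟩
    · obtain ⟨z, -, rfl⟩ := hsingle T hT
      obtain ⟨z', -, rfl⟩ := hsingle T' hT'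
      have h1 : u = z := hu
      have h2 : u = z' := hu'
      rw [← h1, ← h2]
    · obtain ⟨z, hz, rfl⟩ := hsingle T hT
      have h1 : u = z := hu
      have h2 : v = z := hv
      rw [h1, h2]
      exact mem_connectedComponentIn hz
  | succ t ih =>
    by_cases hρ : ρ t
    · obtain ⟨i, hadd, -⟩ := h.restart t hρ
      exact ih.addPoint hε (hx _) hadd
    · obtain ⟨i, q, -, hloc⟩ := h.localStep t hρ
      by_cases hseg : segment ℝ ((st t).pos i) q ⊆ F
      · exact ih.addPoint hε (hseg (right_mem_segment ℝ _ _)) (hloc.1 hseg).1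
      · rwa [hloc.2 hseg]

/-- Restarts never cease, so every sample after the first `k` is added in some iteration. -/
theorem exists_restart_at (h : IsTrajectory F ε qInit x ρ st) {n : ℕ} (hn : k ≤ n) :
    ∃ t, ρ t ∧ k + {s | s < t ∧ ρ s}.ncard = n := by
  classical
  refine ⟨Nat.nth ρ (n - k), Nat.nth_mem_of_infinite h.infinite _, ?_⟩
  rw [ncard_eq_count, Nat.count_nth_of_infinite h.infinite]
  omega

/-- When the `n`-th sample is added, all earlier samples are nodes already. -/
theorem together_self_of_lt (h : IsTrajectory F ε qInit x ρ st) {m t : ℕ}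
    (hm : m < k + {s | s < t ∧ ρ s}.ncard) : Together st t (x m) (x m) := by
  classical
  by_cases hmk : m < k
  · refine h.together_mono (Nat.zero_le t) ?_
    rw [Together, h.init]
    exact ⟨DTree.single (x m), Or.inr ⟨⟨m, hmk⟩, rfl⟩, rfl, rfl⟩
  · rw [ncard_eq_count] at hm
    have hlt : Nat.nth ρ (m - k) < t := Nat.nth_lt_of_lt_count (by omega)
    refine h.together_mono (t := Nat.nth ρ (m - k) + 1) hlt ?_
    obtain ⟨i, hadd, -⟩ := h.restart _ (Nat.nth_mem_of_infinite h.infinite (m - k))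
    obtain ⟨T', hT', hq, -⟩ := hadd.exists_mem
    rw [ncard_eq_count, Nat.count_nth_of_infinite h.infinite, show k + (m - k) = m by omega] at hq
    exact ⟨T', hT', hq, hq⟩

theorem exists_together_self (h : IsTrajectory F ε qInit x ρ st) (n : ℕ) :
    ∃ t, Together st t (x n) (x n) := by
  obtain ⟨t, -, ht⟩ := h.exists_restart_at (n := n + 1 + k) (by omega)
  exact ⟨t, h.together_self_of_lt (by omega)⟩

theorem together_root (h : IsTrajectory F ε qInit x ρ st) (t : ℕ) :
    Together st t qInit qInit := by
  refine h.together_mono (Nat.zero_le t) ?_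
  rw [Together, h.init]
  exact ⟨DTree.single qInit, Or.inl rfl, rfl, rfl⟩

/-- A node that can be linked to a sample shares a tree with it once the sample is added. -/
theorem exists_together_of_canLink (h : IsTrajectory F ε qInit x ρ st) {n t : ℕ} {u : Conf d}
    (hρ : ρ t) (ht : k + {s | s < t ∧ ρ s}.ncard = n) (hu : Together st t u u)
    (hlink : CanLink F ε u (x n)) : ∃ t, Together st t u (x n) := by
  obtain ⟨i, hadd, -⟩ := h.restart t hρ
  rw [ht] at hadd
  obtain ⟨T', hT', hq, hall⟩ := hadd.exists_mem
  obtain ⟨T, hT, huT, -⟩ := hu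
  exact ⟨t + 1, T', hT', hall T hT u huT hlink, hq⟩

theorem exists_together_trans (h : IsTrajectory F ε qInit x ρ st)
    (hfor : ∀ t, IsForest F (st t).trees) {u v w : Conf d} (huv : ∃ t, Together st t u v)
    (hvw : ∃ t, Together st t v w) : ∃ t, Together st t u w := by
  obtain ⟨t, huv⟩ := huv
  obtain ⟨t', hvw⟩ := hvw
  obtain ⟨T, hT, hu, hv⟩ := h.together_mono (le_max_left t t') huv
  obtain ⟨T', hT', hv', hw⟩ := h.together_mono (le_max_right t t') hvw
  obtain rfl := (hfor _).eq_of_mem T hT T' hT' v hv hv'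
  exact ⟨_, T, hT, hu, hw⟩

theorem exists_together_symm {u v : Conf d} (huv : ∃ t, Together st t u v) :
    ∃ t, Together st t v u :=
  let ⟨t, T, hT, hu, hv⟩ := huv
  ⟨t, T, hT, hv, hu⟩

theorem exists_together_of_sampleLink (h : IsTrajectory F ε qInit x ρ st) {m n : ℕ}
    (hmn : SampleLink F ε k x m n) : ∃ t, Together st t (x m) (x n) := by
  have key : ∀ {m n : ℕ}, m < n → k ≤ n → CanLink F ε (x m) (x n) →
      ∃ t, Together st t (x m) (x n) := by
    intro m n hlt hk hlink
    obtain ⟨t, hρ, ht⟩ := h.exists_restart_at hk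
    exact h.exists_together_of_canLink hρ ht (h.together_self_of_lt (by omega)) hlink
  obtain ⟨hlink, hk⟩ := hmn
  rcases lt_trichotomy m n with hlt | rfl | hlt
  · exact key hlt (by omega) hlink
  · exact h.exists_together_self m
  · exact exists_together_symm (key hlt (by omega) hlink.symm)

theorem exists_together_of_reflTransGen (h : IsTrajectory F ε qInit x ρ st)
    (hfor : ∀ t, IsForest F (st t).trees) {m n : ℕ}
    (hmn : Relation.ReflTransGen (SampleLink F ε k x) m n) : ∃ t, Together st t (x m) (x n) := by
  induction hmn with
  | refl => exact h.exists_together_self m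
  | tail _ hlink ih => exact h.exists_together_trans hfor ih (h.exists_together_of_sampleLink hlink)

/-- Every tree contains the root or a sample, whatever the local samplers do. -/
theorem root_mem_or_exists_sample_mem (h : IsTrajectory F ε qInit x ρ st) (t : ℕ) :
    ∀ T ∈ (st t).trees, qInit ∈ T.verts ∨ ∃ n, x n ∈ T.verts := by
  induction t with
  | zero =>
    rw [h.init]
    rintro T (rfl | ⟨i, rfl⟩)
    exacts [Or.inl rfl, Or.inr ⟨i, rfl⟩]
  | succ t ih =>
    intro T' hT'
    have hup : (∃ T ∈ (st t).trees, T.verts ⊆ T'.verts) →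
        qInit ∈ T'.verts ∨ ∃ n, x n ∈ T'.verts := fun ⟨T, hT, hsub⟩ =>
      (ih T hT).imp (fun hq => hsub hq) fun ⟨n, hn⟩ => ⟨n, hsub hn⟩
    by_cases hρ : ρ t
    · obtain ⟨i, hadd, -⟩ := h.restart t hρ
      rcases hadd.exists_subset_verts hT' with hold | ⟨-, hnew⟩
      · exact hup hold
      · exact Or.inr ⟨_, hnew⟩
    · obtain ⟨i, q, hdist, hloc⟩ := h.localStep t hρ
      by_cases hseg : segment ℝ ((st t).pos i) q ⊆ F
      · rcases (hloc.1 hseg).1.exists_subset_verts hT' with hold | ⟨h0, -⟩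
        · exact hup hold
        · exact absurd h0 (h.joinable_nonempty_of_localStep hdist hseg).ne_empty
      · rw [hloc.2 hseg] at hT'
        exact hup ⟨T', hT', le_rfl⟩

/-- Every tree eventually merges with the tree of a sample. -/
theorem exists_together_sample (h : IsTrajectory F ε qInit x ρ st)
    (hx : GoodSamples F ε qInit k x) {t : ℕ} {T : DTree d} (hT : T ∈ (st t).trees) :
    ∃ u ∈ T.verts, ∃ n, ∃ t', Together st t' u (x n) := by
  rcases h.root_mem_or_exists_sample_mem t T hT with hroot | ⟨n, hn⟩
  · obtain ⟨l, hl, hlink⟩ := hx.root_link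
    obtain ⟨t', hρ, ht'⟩ := h.exists_restart_at hl
    exact ⟨qInit, hroot, l, h.exists_together_of_canLink hρ ht' (h.together_root t') hlink⟩
  · exact ⟨x n, hn, n, t, T, hT, hn, hn⟩

theorem eventually_verts_union_subset (h : IsTrajectory F ε qInit x ρ st) (hε : 0 ≤ ε)
    (hq : qInit ∈ F) (hx : GoodSamples F ε qInit k x)
    {z : Conf d} {t : ℕ} {T₁ T₂ : DTree d}
    (hT₁ : T₁ ∈ (st t).trees) (hT₂ : T₂ ∈ (st t).trees)
    (h₁ : T₁.verts ⊆ connectedComponentIn F z) (h₂ : T₂.verts ⊆ connectedComponentIn F z) :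
    ∃ t₀, ∀ s ≥ t₀, ∃ T ∈ (st s).trees, T₁.verts ∪ T₂.verts ⊆ T.verts := by
  have hfor := h.isForest hε hq hx.mem
  obtain ⟨u₁, hu₁, n₁, t₁, ht₁⟩ := h.exists_together_sample hx hT₁
  obtain ⟨u₂, hu₂, n₂, t₂, ht₂⟩ := h.exists_together_sample hx hT₂
  have hcomp : ∀ {u v t}, Together st t u v →
      connectedComponentIn F u = connectedComponentIn F v := fun ⟨T, hT, hu, hv⟩ =>
    connectedComponentIn_eq ((hfor _).component T hT _ hu hv)
  have hn : connectedComponentIn F (x n₁) = connectedComponentIn F (x n₂) := by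
    rw [← hcomp ht₁, ← hcomp ht₂, ← connectedComponentIn_eq (h₁ hu₁),
      ← connectedComponentIn_eq (h₂ hu₂)]
  obtain ⟨t₀, ht₀⟩ := h.exists_together_trans hfor ⟨t₁, ht₁⟩ <|
    h.exists_together_trans hfor (h.exists_together_of_reflTransGen hfor (hx.connected n₁ n₂ hn))
      (exists_together_symm ⟨t₂, ht₂⟩)
  refine ⟨max t t₀, fun s hs => ?_⟩
  obtain ⟨T, hT, hT1, hT2⟩ := h.together_mono (le_of_max_le_right hs) ht₀
  obtain ⟨T₁', hT₁', hsub₁⟩ := h.exists_verts_subset (le_of_max_le_left hs) hT₁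
  obtain ⟨T₂', hT₂', hsub₂⟩ := h.exists_verts_subset (le_of_max_le_left hs) hT₂
  obtain rfl := (hfor s).eq_of_mem T hT T₁' hT₁' u₁ hT1 (hsub₁ hu₁)
  obtain rfl := (hfor s).eq_of_mem T hT T₂' hT₂' u₂ hT2 (hsub₂ hu₂)
  exact ⟨T, hT, Set.union_subset hsub₁ hsub₂⟩

/-- Only finitely many trees are ever created. -/
theorem exists_forall_exists_subset_verts (h : IsTrajectory F ε qInit x ρ st)
    (hx : GoodSamples F ε qInit k x) :
    ∃ t₁, ∀ s ≥ t₁, ∀ T' ∈ (st s).trees, ∃ T ∈ (st t₁).trees, T.verts ⊆ T'.verts := by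
  classical
  obtain ⟨N, hN⟩ := eventually_atTop.1 hx.eventually_link
  refine ⟨Nat.nth ρ N, fun s hs => ?_⟩
  induction s, hs using Nat.le_induction with
  | base => exact fun T' hT' => ⟨T', hT', le_rfl⟩
  | succ s hs ih =>
    intro T' hT'
    have hup : (∃ T ∈ (st s).trees, T.verts ⊆ T'.verts) →
        ∃ T ∈ (st (Nat.nth ρ N)).trees, T.verts ⊆ T'.verts := fun ⟨T, hT, hsub⟩ =>
      let ⟨T₀, hT₀, hsub₀⟩ := ih T hT
      ⟨T₀, hT₀, hsub₀.trans hsub⟩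
    by_cases hρ : ρ s
    · obtain ⟨i, hadd, -⟩ := h.restart s hρ
      rcases hadd.exists_subset_verts hT' with hold | ⟨h0, -⟩
      · exact hup hold
      · have hcount : N ≤ k + {r | r < s ∧ ρ r}.ncard := by
          have := Nat.count_monotone ρ hs
          rw [Nat.count_nth_of_infinite h.infinite] at this
          rw [ncard_eq_count]
          omega
        obtain ⟨m, hm, hlink⟩ := hN _ hcount
        obtain ⟨T, hT, hmT, -⟩ := h.together_self_of_lt hm
        have hTJ : T ∈ joinable F ε (st s).trees (x (k + {r | r < s ∧ ρ r}.ncard)) :=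
          ⟨hT, _, hmT, hlink⟩
        rw [h0] at hTJ
        exact hTJ.elim
    · obtain ⟨i, q, hdist, hloc⟩ := h.localStep s hρ
      by_cases hseg : segment ℝ ((st s).pos i) q ⊆ F
      · rcases (hloc.1 hseg).1.exists_subset_verts hT' with hold | ⟨h0, -⟩
        · exact hup hold
        · exact absurd h0 (h.joinable_nonempty_of_localStep hdist hseg).ne_empty
      · rw [hloc.2 hseg] at hT'
        exact hup ⟨T', hT', le_rfl⟩

theorem eventually_existsUnique (h : IsTrajectory F ε qInit x ρ st) (hε : 0 ≤ ε)
    (hq : qInit ∈ F) (hx : GoodSamples F ε qInit k x)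
    {z : Conf d} (hz : z ∈ F) :
    ∃ t₀, ∀ s ≥ t₀, ∃! T : DTree d, T ∈ (st s).trees ∧ T.verts ⊆ connectedComponentIn F z := by
  have hfor := h.isForest hε hq hx.mem
  obtain ⟨t₁, ht₁⟩ := h.exists_forall_exists_subset_verts hx
  obtain ⟨n, hn⟩ := hx.exists_mem_component z hz
  obtain ⟨t₂, ht₂⟩ := h.exists_together_self n
  -- From `t₃` on, any two trees of time `t₁` inside the component have merged.
  obtain ⟨t₃, ht₃⟩ : ∃ t₃, ∀ T₁ ∈ (st t₁).trees, ∀ T₂ ∈ (st t₁).trees,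
      T₁.verts ⊆ connectedComponentIn F z → T₂.verts ⊆ connectedComponentIn F z →
      ∀ s ≥ t₃, ∃ T ∈ (st s).trees, T₁.verts ∪ T₂.verts ⊆ T.verts := by
    have hev : ∀ᶠ s in atTop, ∀ T₁ ∈ (st t₁).trees, ∀ T₂ ∈ (st t₁).trees,
        T₁.verts ⊆ connectedComponentIn F z → T₂.verts ⊆ connectedComponentIn F z →
        ∃ T ∈ (st s).trees, T₁.verts ∪ T₂.verts ⊆ T.verts := by
      refine (eventually_all_finite (hfor t₁).finite).2 fun T₁ hT₁ =>
        (eventually_all_finite (hfor t₁).finite).2 fun T₂ hT₂ => ?_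
      by_cases hC : T₁.verts ⊆ connectedComponentIn F z ∧ T₂.verts ⊆ connectedComponentIn F z
      · obtain ⟨t₀, ht₀⟩ := h.eventually_verts_union_subset hε hq hx hT₁ hT₂ hC.1 hC.2
        exact eventually_atTop.2 ⟨t₀, fun s hs _ _ => ht₀ s hs⟩
      · exact Eventually.of_forall fun s h1 h2 => absurd ⟨h1, h2⟩ hC
    obtain ⟨t₃, ht₃⟩ := eventually_atTop.1 hev
    exact ⟨t₃, fun T₁ hT₁ T₂ hT₂ h1 h2 s hs => ht₃ s hs T₁ hT₁ T₂ hT₂ h1 h2⟩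
  refine ⟨max t₁ (max t₂ t₃), fun s hs => ?_⟩
  simp only [ge_iff_le, max_le_iff] at hs
  obtain ⟨hs₁, hs₂, hs₃⟩ := hs
  obtain ⟨T, hT, hnT, -⟩ := h.together_mono hs₂ ht₂
  have hTC : T.verts ⊆ connectedComponentIn F z := by
    rw [connectedComponentIn_eq hn]
    exact (hfor s).component T hT _ hnT
  refine ⟨T, ⟨hT, hTC⟩, fun T' ⟨hT', hTC'⟩ => ?_⟩
  obtain ⟨T₀, hT₀, hsub⟩ := ht₁ s hs₁ T hT
  obtain ⟨T₀', hT₀', hsub'⟩ := ht₁ s hs₁ T' hT'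
  obtain ⟨U, hU, hUsub⟩ := ht₃ T₀ hT₀ T₀' hT₀' (hsub.trans hTC) (hsub'.trans hTC') s hs₃
  obtain ⟨u, hu⟩ := (hfor t₁).nonempty T₀ hT₀
  obtain ⟨v, hv⟩ := (hfor t₁).nonempty T₀' hT₀'
  rw [(hfor s).eq_of_mem T hT U hU u (hsub hu) (hUsub (Or.inl hu)),
    (hfor s).eq_of_mem T' hT' U hU v (hsub' hv) (hUsub (Or.inr hv))]

end IsTrajectory

/-- Restarts never cease: otherwise some arm would be picked infinitely often and, from some time on,
never be replaced, so that its probability would fall below the threshold. -/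
theorem frequently_restarts {k : ℕ} {η : ℝ} (hη : 0 < η) {prob : ℕ → Fin k → ℝ}
    {arm : ℕ → Fin k} {replaced : Fin k → ℕ → Prop}
    (hrep : ∀ i t, replaced i t → ∃ j, prob t j < η)
    (hdecay : ∀ i, (∃ᶠ t in atTop, (¬ ∃ j, prob t j < η) ∧ arm t = i) →
      (∀ᶠ t in atTop, ¬ replaced i t) → Tendsto (fun t => prob t i) atTop (𝓝 0)) :
    ∃ᶠ t in atTop, ∃ j, prob t j < η := by
  intro hev
  obtain ⟨i, hi⟩ : ∃ i, ∃ᶠ t in atTop, arm t = i := by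
    by_contra hcon
    simp only [not_exists, not_frequently] at hcon
    obtain ⟨t, ht⟩ := (eventually_all.2 hcon).exists
    exact ht (arm t) rfl
  have hlim := hdecay i ((hi.and_eventually hev).mono fun t ht => ⟨ht.2, ht.1⟩)
    (hev.mono fun t ht hr => ht (hrep i t hr))
  obtain ⟨t, ht, ht'⟩ := ((hlim.eventually_lt_const hη).and hev).exists
  exact ht' ⟨i, ht⟩

/-- Almost every outcome of a run is a trajectory driven by good samples. -/
theorem Run.ae_isTrajectory {d : ℕ} {F : Set (Conf d)} {qInit : Conf d} {k : ℕ} {ε η : ℝ}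
    (hη : 0 < η) {Ω : Type*} [MeasurableSpace Ω] {P : Measure Ω}
    (R : Run F qInit k ε η P) (hdecay : R.ArmsDecay) :
    ∀ᵐ ω ∂P, IsTrajectory F ε qInit (fun n => R.sample n ω) (R.Restarts ω)
      (fun t => R.state t ω) := by
  filter_upwards [hdecay, R.init, R.restart_step, R.local_step] with ω hdecay hinit hrestart hlocal
  refine ⟨hinit, fun t ht => ?_, fun t ht => ?_, ?_⟩
  · obtain ⟨-, n, rfl, hstep⟩ := hrestart t ht
    exact ⟨_, hstep⟩
  · exact ⟨_, _, hlocal t ht⟩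
  · exact Nat.frequently_atTop_iff_infinite.1
      (frequently_restarts hη (fun i t hr => hr.1) hdecay)

end RRdT

theorem mainTheorem3 {d : ℕ} (hd : 2 ≤ d) (C Cobs : Set (RRdT.Conf d)) (hobs : Cobs ⊆ C)
    (hbdd : Bornology.IsBounded (RRdT.freeSpace C Cobs))
    {α β δ : ℝ} (hα : 0 < α) (hβ : 0 < β) (hδ : 0 < δ)
    (hexp : RRdT.IsExpansive (RRdT.freeSpace C Cobs) α β δ)
    (qInit : RRdT.Conf d) (hq : qInit ∈ RRdT.freeSpace C Cobs)
    (k : ℕ) (hk : 1 ≤ k) {ε η : ℝ} (hε : 0 < ε) (hη : 0 < η)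
    {Ω : Type*} [MeasurableSpace Ω] (P : Measure Ω) [IsProbabilityMeasure P]
    (R : RRdT.Run (RRdT.freeSpace C Cobs) qInit k ε η P) (hdecay : R.ArmsDecay) :
    (∀ᵐ ω ∂P, ∀ x ∈ RRdT.freeSpace C Cobs, ∀ t : ℕ, ∀ T₁ ∈ R.trees ω t, ∀ T₂ ∈ R.trees ω t,
      T₁ ≠ T₂ →
      T₁.verts ⊆ connectedComponentIn (RRdT.freeSpace C Cobs) x →
      T₂.verts ⊆ connectedComponentIn (RRdT.freeSpace C Cobs) x →
      (∃ u ∈ T₁.verts, ∃ v ∈ T₂.verts, JoinedIn (RRdT.freeSpace C Cobs) u v) →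
      ∃ t₀ : ℕ, ∀ s ≥ t₀, ∃ T ∈ R.trees ω s, T₁.verts ∪ T₂.verts ⊆ T.verts) ∧
    (∀ᵐ ω ∂P, ∀ x ∈ RRdT.freeSpace C Cobs, ∃ t₀ : ℕ, ∀ s ≥ t₀,
      ∃! T : RRdT.DTree d, T ∈ R.trees ω s ∧
        T.verts ⊆ connectedComponentIn (RRdT.freeSpace C Cobs) x) := by
  have hF : IsClosed (RRdT.freeSpace C Cobs) := isClosed_closure
  have hgood := RRdT.ae_goodSamples hF hbdd hα hβ hδ hε hexp hq k R.measurable_sample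
    R.indep_sample R.uniform_sample
  have htraj := R.ae_isTrajectory hη hdecay
  constructor
  · filter_upwards [hgood, htraj] with ω hx h
    exact fun z _ t T₁ hT₁ T₂ hT₂ _ h₁ h₂ _ =>
      h.eventually_verts_union_subset hε.le hq hx hT₁ hT₂ h₁ h₂
  · filter_upwards [hgood, htraj] with ω hx h
    exact fun z hz => h.eventually_existsUnique hε.le hq hx hz
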